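/- Let $n\ge 4$ be an integer and, for $t\in\mathbb C$, let $f_t(z,w)=z^n+t z^{n-1}w+w^n$. For each $t$ such that the binary form $f_t$ is square-free (that is, has no repeated linear factor), let $\mathcal V_t$ be the germ at the origin of the plane curve $\{f_t=0\}\subset\mathbb C^2$. Two plane curve germs $\mathcal V_1,\mathcal V_2$ at the origin of $\mathbb C^2$ are called biholomorphically equivalent if there are a biholomorphic map $F:U_1\to U_2$ between (connected) open neighbourhoods of the origin in $\mathbb C^2$ with $F(0)=0$ and plane curves $V_1\subset U_1$, $V_2\subset U_2$ (zero sets of holomorphic functions on $U_1$, $U_2$ that are not identically zero) representing $\mathcal V_1$, $\mathcal V_2$, such that $F(V_1)=V_2$. Let $t_1,t_2\in\mathbb C$ be such that $f_{t_1}$ and $f_{t_2}$ are square-free. Then $\mathcal V_{t_1}$ and $\mathcal V_{t_2}$ are biholomorphically equivalent if and only if $t_1^n=t_2^n$. -/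

import Mathlib

open Topology

/-- The complex plane `ℂ²`; the coordinates of a point `p` are `z = p 0` and `w = p 1`. -/
abbrev C2 : Type := Fin 2 → ℂ

/-- Germs at the origin of subsets of `ℂ²`: subsets (as predicates) up to equality near `0`. -/
abbrev SetGerm : Type := Filter.Germ (𝓝 (0 : C2)) Prop

/-- The germ at the origin of the subset `V` of `ℂ²`. -/
noncomputable def germAtZero (V : Set C2) : SetGerm := ((fun p : C2 => p ∈ V) : C2 → Prop)

/-- `V` is a plane curve in the domain `U ⊆ ℂ²`: the zero set in `U` of a function that is
holomorphic in `U` and not identically zero there. -/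
def IsPlaneCurveIn (V U : Set C2) : Prop :=
  IsOpen U ∧ IsConnected U ∧
    ∃ f : C2 → ℂ, DifferentiableOn ℂ f U ∧ (∃ p ∈ U, f p ≠ 0) ∧ V = {p ∈ U | f p = 0}

/-- Biholomorphic equivalence of plane curve germs at the origin: there is a biholomorphic map `F`
from a neighbourhood `F.source` of `0` onto a neighbourhood `F.target` of `0`, with `F 0 = 0`,
that maps a plane curve representing the first germ onto a plane curve representing the second. -/
def BiholomorphicallyEquivalent (𝒱₁ 𝒱₂ : SetGerm) : Prop :=
  ∃ F : OpenPartialHomeomorph C2 C2,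
    (0 : C2) ∈ F.source ∧ F 0 = 0 ∧
    DifferentiableOn ℂ F F.source ∧ DifferentiableOn ℂ F.symm F.target ∧
    ∃ V₁ V₂ : Set C2,
      IsPlaneCurveIn V₁ F.source ∧ IsPlaneCurveIn V₂ F.target ∧
      germAtZero V₁ = 𝒱₁ ∧ germAtZero V₂ = 𝒱₂ ∧ F '' V₁ = V₂

/-- The binary form `f_t = z ^ n + t z ^ (n - 1) w + w ^ n`, with `z = X 0` and `w = X 1`. -/
noncomputable def familyForm (n : ℕ) (t : ℂ) : MvPolynomial (Fin 2) ℂ :=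
  MvPolynomial.X 0 ^ n
    + MvPolynomial.C t * MvPolynomial.X 0 ^ (n - 1) * MvPolynomial.X 1
    + MvPolynomial.X 1 ^ n

/-- The germ at the origin of the curve `f_t = 0` in `ℂ²`. -/
noncomputable def curveGerm (n : ℕ) (t : ℂ) : SetGerm :=
  germAtZero {p : C2 | MvPolynomial.eval p (familyForm n t) = 0}

open MvPolynomial Filter Matrix

/-!
Let a biholomorphism `F` carry the germ of a square-free form `f` into the germ of a form `g` of
the same degree. Both zero sets are cones, so `g (F (r v) / r) = 0` for small `r` whenever
`f v = 0`, and letting `r → 0` shows that `g ∘ dF₀` vanishes on the zeros of `f`. By the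
Nullstellensatz `f` divides `g ∘ dF₀`, and comparing degrees the two forms are proportional: `f`
and `g` are linearly equivalent.

Linear equivalence within the family determines `t ^ n`. For `n ≥ 5` and `t ≠ 0` the only
operators `∂_v ∂_u²` with independent `u`, `v` that annihilate `f_t` are the multiples of
`∂_z ∂_w²`, so the substitution is diagonal and `t ^ n` is read off the coefficients. For `n = 4`
the classical invariants of `f_t` are, up to scaling, `I = 12` and `J = -27 t²`, so `J² / I³`
recovers `t ^ 4`.
Conversely, if `t₁ ^ n = t₂ ^ n`, rescaling `w` by an `n`-th root of unity carries one form to the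
other.

If `f_t` has a repeated factor, it has a nonzero singular point, which forces
`(1 - n) ^ (n - 1) t ^ n = -n ^ n` and hence fixes `t ^ n`.
-/

section LinearSubstitution

variable {σ τ ρ R : Type*} [CommRing R]

/-- The polynomial `p ∘ M` obtained from `p` by the linear change of variables with matrix `M`;
the variables of `p` index the rows of `M`. -/
noncomputable def linSubst [Fintype τ] (M : Matrix σ τ R) :
    MvPolynomial σ R →ₐ[R] MvPolynomial τ R :=
  bind₁ M.toMvPolynomial

theorem eval_linSubst [Fintype τ] (M : Matrix σ τ R) (p : MvPolynomial σ R) (v : τ → R) :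
    eval v (linSubst M p) = eval (M *ᵥ v) p := by
  simp only [linSubst, ← aeval_eq_eval, aeval_bind₁]
  simp only [aeval_eq_eval, toMvPolynomial_eval_eq_apply]

theorem linSubst_X [Fintype τ] (M : Matrix σ τ R) (i : σ) :
    linSubst M (X i) = ∑ j, C (M i j) * X j := by
  simp only [linSubst, bind₁_X_right, toMvPolynomial, C_mul_X_eq_monomial]

theorem linSubst_one [Fintype σ] [DecidableEq σ] (p : MvPolynomial σ R) :
    linSubst (1 : Matrix σ σ R) p = p := by
  rw [linSubst, toMvPolynomial_one, bind₁_X_left, AlgHom.id_apply]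

theorem linSubst_linSubst [Fintype τ] [Fintype ρ] (M : Matrix σ τ R) (N : Matrix τ ρ R)
    (p : MvPolynomial σ R) : linSubst N (linSubst M p) = linSubst (M * N) p := by
  simp only [linSubst, bind₁_bind₁, ← toMvPolynomial_mul]

theorem isHomogeneous_linSubst [Fintype τ] (M : Matrix σ τ R) {p : MvPolynomial σ R} {n : ℕ}
    (hp : p.IsHomogeneous n) : (linSubst M p).IsHomogeneous n := by
  simpa only [one_mul, linSubst] using! hp.aeval M.toMvPolynomial M.toMvPolynomial_isHomogeneous

theorem linSubst_ne_zero [Fintype σ] [DecidableEq σ] (M : GL σ R) {p : MvPolynomial σ R}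
    (hp : p ≠ 0) : linSubst (M : Matrix σ σ R) p ≠ 0 := by
  intro h
  have hinv := linSubst_linSubst M.1 M⁻¹.1 p
  rw [h, map_zero, Units.mul_inv, linSubst_one] at hinv
  exact hp hinv.symm

/-- Two polynomials are linearly equivalent if an invertible linear change of variables carries
the first to a unit multiple of the second. -/
def IsLinearlyEquivalent [Fintype σ] [DecidableEq σ] (p q : MvPolynomial σ R) : Prop :=
  ∃ (M : GL σ R) (k : Rˣ), linSubst (M : Matrix σ σ R) p = k • q

theorem IsLinearlyEquivalent.symm [Fintype σ] [DecidableEq σ] {p q : MvPolynomial σ R}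
    (h : IsLinearlyEquivalent p q) : IsLinearlyEquivalent q p := by
  obtain ⟨M, k, h⟩ := h
  refine ⟨M⁻¹, k⁻¹, ?_⟩
  calc linSubst M⁻¹.1 q
      = k⁻¹ • linSubst M⁻¹.1 (k • q) := by
        rw [Units.smul_def k, map_smul, ← Units.smul_def, inv_smul_smul]
    _ = k⁻¹ • p := by rw [← h, linSubst_linSubst, Units.mul_inv, linSubst_one]

/-- The derivation of the polynomial ring that differentiates in the constant direction `v`. -/
noncomputable def dirDeriv (v : σ → R) : Derivation R (MvPolynomial σ R) (MvPolynomial σ R) :=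
  mkDerivation R fun i => C (v i)

theorem dirDeriv_X (v : σ → R) (i : σ) : dirDeriv v (X i) = C (v i) :=
  mkDerivation_X R _ i

theorem dirDeriv_C (v : σ → R) (r : R) : dirDeriv v (C r) = 0 :=
  derivation_C _ r

theorem dirDeriv_linSubst [Fintype τ] (M : Matrix σ τ R) (v : τ → R)
    (p : MvPolynomial σ R) :
    dirDeriv v (linSubst M p) = linSubst M (dirDeriv (M *ᵥ v) p) := by
  have hC (r : R) : linSubst M (C r) = C r := algHom_C _ r
  induction p using MvPolynomial.induction_on with
  | C r => simp only [hC, dirDeriv_C, map_zero]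
  | add p q hp hq => simp only [map_add, hp, hq]
  | mul_X p i hp =>
    have hX : dirDeriv v (linSubst M (X i)) = C ((M *ᵥ v) i) := by
      simp [linSubst_X, Derivation.leibniz, dirDeriv_X, mulVec, dotProduct]
    simp only [map_mul, map_add, Derivation.leibniz, hp, hX, dirDeriv_X, smul_eq_mul, hC]

end LinearSubstitution

section Nullstellensatz

variable {σ K : Type*} [Finite σ] [Field K] [IsAlgClosed K]

theorem exists_dvd_pow_of_forall_eval_eq_zero {f g : MvPolynomial σ K}
    (h : ∀ v, eval v f = 0 → eval v g = 0) : ∃ m : ℕ, f ∣ g ^ m := by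
  have hmem : g ∈ vanishingIdeal K (zeroLocus K (Ideal.span {f})) := by
    simpa [zeroLocus_span, mem_vanishingIdeal_iff, aeval_eq_eval] using h
  rw [vanishingIdeal_zeroLocus_eq_radical] at hmem
  exact hmem.imp fun m hm => Ideal.mem_span_singleton.mp hm

theorem exists_eq_smul_of_forall_eval_eq_zero {n : ℕ} {f g : MvPolynomial σ K}
    (hf : Squarefree f) (hfn : f.IsHomogeneous n) (hgn : g.IsHomogeneous n) (hg : g ≠ 0)
    (h : ∀ v, eval v f = 0 → eval v g = 0) : ∃ k : Kˣ, g = k • f := by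
  obtain ⟨m, hm⟩ := exists_dvd_pow_of_forall_eval_eq_zero h
  obtain ⟨q, rfl⟩ := hf.isRadical m g hm
  have hf0 := left_ne_zero_of_mul hg
  have hq0 := right_ne_zero_of_mul hg
  have hdeg := totalDegree_mul_of_isDomain hf0 hq0
  rw [hfn.totalDegree hf0, hgn.totalDegree hg] at hdeg
  have hqC : q = C (coeff 0 q) := totalDegree_eq_zero_iff_eq_C.mp (by omega)
  have hk : coeff 0 q ≠ 0 := fun hk => hq0 (by rw [hqC, hk, C_0])
  refine ⟨Units.mk0 _ hk, ?_⟩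
  rw [Units.smul_def, Units.val_mk0, smul_eq_C_mul, ← hqC, mul_comm]

theorem exists_ne_zero_eval_eq_zero [Nontrivial σ] {p : MvPolynomial σ K} (hp : ¬IsUnit p) :
    ∃ v ≠ 0, eval v p = 0 := by
  by_contra! hv
  have hX (i : σ) : ∃ m : ℕ, p ∣ X i ^ m := by
    refine exists_dvd_pow_of_forall_eval_eq_zero fun v hpv => ?_
    have hv0 : v = 0 := by_contra fun hv0 => hv v hv0 hpv
    simp [hv0]
  obtain ⟨i, j, hij⟩ := exists_pair_ne σ
  obtain ⟨a, hi⟩ := hX i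
  obtain ⟨b, hj⟩ := hX j
  have hrel : IsRelPrime (X i : MvPolynomial σ K) (X j) :=
    (X_prime.irreducible.isRelPrime_iff_not_dvd).mpr (by simpa using hij)
  exact hp (hrel.pow hi hj)

theorem exists_singular_point_of_not_squarefree [Nontrivial σ] {f : MvPolynomial σ K}
    (hf : ¬Squarefree f) : ∃ v ≠ 0, ∀ i, eval v (pderiv i f) = 0 := by
  obtain ⟨p, ⟨q, rfl⟩, hp⟩ : ∃ p, p * p ∣ f ∧ ¬IsUnit p := by
    simpa only [Squarefree, not_forall, exists_prop] using hf
  obtain ⟨v, hv, hpv⟩ := exists_ne_zero_eval_eq_zero hp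
  exact ⟨v, hv, fun i => by simp [hpv]⟩

end Nullstellensatz

section FamilyForm

theorem eval_familyForm (n : ℕ) (t : ℂ) (p : C2) :
    eval p (familyForm n t) = p 0 ^ n + t * p 0 ^ (n - 1) * p 1 + p 1 ^ n := by
  simp [familyForm]

theorem isHomogeneous_familyForm {n : ℕ} (hn : 1 ≤ n) (t : ℂ) :
    (familyForm n t).IsHomogeneous n := by
  have hmid := ((isHomogeneous_C (Fin 2) t).mul
    (isHomogeneous_X_pow (R := ℂ) (0 : Fin 2) (n - 1))).mul (isHomogeneous_X ℂ (1 : Fin 2))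
  rw [show 0 + (n - 1) + 1 = n by omega] at hmid
  exact ((isHomogeneous_X_pow _ _).add hmid).add (isHomogeneous_X_pow _ _)

theorem familyForm_ne_zero {n : ℕ} (hn : 1 ≤ n) (t : ℂ) : familyForm n t ≠ 0 := by
  intro h
  have h10 := congrArg (eval ![1, 0]) h
  simp [eval_familyForm, Nat.one_le_iff_ne_zero.mp hn] at h10

theorem eval_pderiv_zero_familyForm (m : ℕ) (t : ℂ) (p : C2) :
    eval p (pderiv 0 (familyForm (m + 2) t)) =
      (m + 2) * p 0 ^ (m + 1) + t * (m + 1) * p 0 ^ m * p 1 := by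
  simp [familyForm, pderiv_X, mul_assoc, mul_comm, mul_left_comm]

theorem eval_pderiv_one_familyForm (m : ℕ) (t : ℂ) (p : C2) :
    eval p (pderiv 1 (familyForm (m + 2) t)) = t * p 0 ^ (m + 1) + (m + 2) * p 1 ^ (m + 1) := by
  simp [familyForm, pderiv_X]

theorem pow_mul_pow_eq_neg_pow_of_not_squarefree {n : ℕ} (hn : 2 ≤ n) {t : ℂ}
    (h : ¬Squarefree (familyForm n t)) : (1 - n : ℂ) ^ (n - 1) * t ^ n = -n ^ n := by
  obtain ⟨v, hv, hpd⟩ := exists_singular_point_of_not_squarefree h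
  obtain ⟨m, rfl⟩ := Nat.exists_eq_add_of_le' hn
  have hz : (m + 2) * v 0 ^ (m + 1) + t * (m + 1) * v 0 ^ m * v 1 = 0 := by
    rw [← eval_pderiv_zero_familyForm, hpd]
  have hw : t * v 0 ^ (m + 1) + (m + 2) * v 1 ^ (m + 1) = 0 := by
    rw [← eval_pderiv_one_familyForm, hpd]
  have hm2 : (m + 2 : ℂ) ≠ 0 := by exact_mod_cast (m + 1).succ_ne_zero
  have hv0 : v 0 ≠ 0 := by
    intro hv0
    have hv1 : v 1 = 0 := by simpa [hv0, hm2] using hw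
    exact hv (by ext i; fin_cases i <;> assumption)
  have hlin : (m + 2) * v 0 = (1 - (m + 2)) * t * v 1 := by
    refine mul_left_cancel₀ (pow_ne_zero m hv0) ?_
    linear_combination hz
  have hpow := congrArg (· ^ (m + 1)) hlin
  simp only [mul_pow] at hpow
  push_cast [Nat.add_succ_sub_one]
  refine mul_right_cancel₀ (pow_ne_zero (m + 1) hv0) ?_
  linear_combination (m + 2 : ℂ) * hpow + (1 - (m + 2 : ℂ)) ^ (m + 1) * t ^ (m + 1) * hw

theorem pow_eq_pow_of_not_squarefree {n : ℕ} (hn : 2 ≤ n) {t₁ t₂ : ℂ}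
    (h₁ : ¬Squarefree (familyForm n t₁)) (h₂ : ¬Squarefree (familyForm n t₂)) :
    t₁ ^ n = t₂ ^ n := by
  have hn1 : (1 - n : ℂ) ≠ 0 := sub_ne_zero.mpr (by exact_mod_cast (by omega : 1 ≠ n))
  refine mul_left_cancel₀ (pow_ne_zero (n - 1) hn1) ?_
  rw [pow_mul_pow_eq_neg_pow_of_not_squarefree hn h₁,
    pow_mul_pow_eq_neg_pow_of_not_squarefree hn h₂]

theorem linSubst_diagonal_familyForm {n : ℕ} (t : ℂ) {ζ : ℂ} (hζ : ζ ^ n = 1) :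
    linSubst (diagonal ![1, ζ]) (familyForm n t) = familyForm n (ζ * t) := by
  refine MvPolynomial.funext fun p => ?_
  simp only [eval_linSubst, eval_familyForm, mulVec_diagonal, cons_val_zero, cons_val_one,
    mul_pow, hζ]
  ring

theorem isLinearlyEquivalent_of_pow_eq_pow {n : ℕ} (hn : n ≠ 0) {s t : ℂ} (h : s ^ n = t ^ n) :
    IsLinearlyEquivalent (familyForm n s) (familyForm n t) := by
  obtain ⟨ζ, hζ, rfl⟩ : ∃ ζ : ℂ, ζ ^ n = 1 ∧ t = ζ * s := by
    rcases eq_or_ne s 0 with rfl | hs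
    · exact ⟨1, one_pow n, by simpa [hn, eq_comm] using h⟩
    · exact ⟨t / s, by rw [div_pow, ← h, div_self (pow_ne_zero n hs)],
        (div_mul_cancel₀ t hs).symm⟩
  have hζ0 : ζ ≠ 0 := by rintro rfl; simp [hn] at hζ
  refine ⟨GeneralLinearGroup.mkOfDetNeZero (diagonal ![1, ζ]) (by simpa using hζ0), 1, ?_⟩
  rw [one_smul, ← linSubst_diagonal_familyForm s hζ]
  rfl

theorem pow_eq_pow_of_linSubst_diagonal_familyForm_eq {n : ℕ} (hn : 2 ≤ n) {s t k : ℂ}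
    {d : Fin 2 → ℂ} (hk : k ≠ 0)
    (h : linSubst (diagonal d) (familyForm n s) = k • familyForm n t) : s ^ n = t ^ n := by
  obtain ⟨m, rfl⟩ := Nat.exists_eq_add_of_le' hn
  have heval (z w : ℂ) : (d 0 * z) ^ (m + 2) + s * (d 0 * z) ^ (m + 1) * (d 1 * w)
      + (d 1 * w) ^ (m + 2) = k * (z ^ (m + 2) + t * z ^ (m + 1) * w + w ^ (m + 2)) := by
    have := congrArg (eval ![z, w]) h
    simpa [eval_linSubst, eval_familyForm, mulVec_diagonal] using this
  have hz : d 0 ^ (m + 2) = k := by simpa using heval 1 0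
  have hw : d 1 ^ (m + 2) = k := by simpa using heval 0 1
  have hzw : s * d 0 ^ (m + 1) * d 1 = k * t := by
    linear_combination heval 1 1 - hz - hw
  refine mul_left_cancel₀ (pow_ne_zero (m + 2) hk) ?_
  calc k ^ (m + 2) * s ^ (m + 2) = (d 0 ^ (m + 2)) ^ (m + 1) * d 1 ^ (m + 2) * s ^ (m + 2) := by
        rw [hz, hw, pow_succ k]
    _ = (s * d 0 ^ (m + 1) * d 1) ^ (m + 2) := by ring
    _ = k ^ (m + 2) * t ^ (m + 2) := by rw [hzw, mul_pow]

theorem dirDeriv_familyForm_eq_zero (n : ℕ) (t : ℂ) :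
    dirDeriv (Pi.single 0 1) (dirDeriv (Pi.single 1 1) (dirDeriv (Pi.single 1 1)
      (familyForm n t))) = 0 := by
  simp [familyForm, Derivation.leibniz, Derivation.leibniz_pow, dirDeriv_X]

theorem eval_dirDeriv_familyForm (m : ℕ) (t : ℂ) (u v p : C2) :
    eval p (dirDeriv v (dirDeriv u (dirDeriv u (familyForm (m + 5) t)))) =
      (m + 4) * (m + 3) * ((v 0 * u 0 ^ 2 * (m + 5) + (2 * v 0 * u 0 * u 1 + v 1 * u 0 ^ 2) * t)
          * p 0 ^ (m + 2)
        + v 0 * u 0 ^ 2 * t * (m + 2) * p 0 ^ (m + 1) * p 1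
        + v 1 * u 1 ^ 2 * (m + 5) * p 1 ^ (m + 2)) := by
  simp only [familyForm, map_add, map_mul, map_pow, Derivation.leibniz, Derivation.leibniz_pow,
    dirDeriv_X, dirDeriv_C, Derivation.map_natCast, smul_eq_mul, nsmul_eq_mul, mul_zero, add_zero,
    zero_add, map_natCast, eval_C, eval_X, Nat.add_succ_sub_one]
  push_cast
  ring

theorem eq_zero_of_dirDeriv_familyForm_eq_zero {n : ℕ} (hn : 5 ≤ n) {t : ℂ} (ht : t ≠ 0) {u v : C2}
    (huv : v 0 * u 1 - u 0 * v 1 ≠ 0)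
    (h : dirDeriv v (dirDeriv u (dirDeriv u (familyForm n t))) = 0) : u 0 = 0 ∧ v 1 = 0 := by
  obtain ⟨m, rfl⟩ := Nat.exists_eq_add_of_le' hn
  have hm2 : (m + 2 : ℂ) ≠ 0 := by exact_mod_cast (m + 1).succ_ne_zero
  have hm3 : (m + 3 : ℂ) ≠ 0 := by exact_mod_cast (m + 2).succ_ne_zero
  have hm4 : (m + 4 : ℂ) ≠ 0 := by exact_mod_cast (m + 3).succ_ne_zero
  have hm5 : (m + 5 : ℂ) ≠ 0 := by exact_mod_cast (m + 4).succ_ne_zero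
  have heval (p : C2) := (eval_dirDeriv_familyForm m t u v p).symm
  simp only [h, map_zero, mul_eq_zero, hm3, hm4, false_or] at heval
  have hw : v 1 * u 1 ^ 2 = 0 := by simpa [hm5] using heval ![0, 1]
  have hz : v 0 * u 0 ^ 2 * (m + 5) + (2 * v 0 * u 0 * u 1 + v 1 * u 0 ^ 2) * t = 0 := by
    simpa using heval ![1, 0]
  have hzw : v 0 * u 0 ^ 2 = 0 := by
    have h11 : v 0 * u 0 ^ 2 * (t * (m + 2)) = 0 := by
      have := heval ![1, 1]
      simp only [cons_val_zero, cons_val_one, one_pow, mul_one] at this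
      linear_combination this - hz - (m + 5) * hw
    simpa [ht, hm2] using h11
  have hmix : (2 * v 0 * u 1 + v 1 * u 0) * u 0 = 0 := by
    refine mul_right_cancel₀ ht ?_
    linear_combination hz - (m + 5) * hzw
  have hu0 : u 0 = 0 := by
    by_contra hu0
    have hv0 : v 0 = 0 := by simpa [hu0] using hzw
    have hv1 : v 1 = 0 := by simpa [hu0, hv0] using hmix
    simp [hv0, hv1] at huv
  have hu1 : u 1 ≠ 0 := by
    intro hu1
    simp [hu0, hu1] at huv
  exact ⟨hu0, by simpa [hu1] using hw⟩

theorem pow_eq_pow_of_linSubst_familyForm_eq_of_five_le {n : ℕ} (hn : 5 ≤ n) {s t : ℂ}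
    (hs : s ≠ 0) {M : GL (Fin 2) ℂ} {k : ℂ} (hk : k ≠ 0)
    (h : linSubst M.1 (familyForm n s) = k • familyForm n t) : s ^ n = t ^ n := by
  have hzero : dirDeriv (M.1.col 0) (dirDeriv (M.1.col 1) (dirDeriv (M.1.col 1)
      (familyForm n s))) = 0 := by
    by_contra hne
    apply linSubst_ne_zero M hne
    simp only [← mulVec_single_one, ← dirDeriv_linSubst, h, Derivation.map_smul,
      dirDeriv_familyForm_eq_zero, smul_zero]
  obtain ⟨h01, h10⟩ :=
    eq_zero_of_dirDeriv_familyForm_eq_zero hn hs (by simpa [det_fin_two] using M.det_ne_zero) hzero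
  have hM : M.1 = diagonal ![M.1 0 0, M.1 1 1] := by
    ext i j
    fin_cases i <;> fin_cases j <;> simp_all
  rw [hM] at h
  exact pow_eq_pow_of_linSubst_diagonal_familyForm_eq (by omega) hk h

end FamilyForm

section BinaryQuartic

variable {R : Type*} [CommRing R]

/-- The exponent of the monomial `X 0 ^ (4 - i) * X 1 ^ i`. -/
noncomputable def quarticExponent (i : Fin 5) : Fin 2 →₀ ℕ :=
  .single 0 (4 - i.val) + .single 1 i.val

theorem quarticExponent_injective : Function.Injective quarticExponent := by
  intro i j h
  exact Fin.ext (by simpa [quarticExponent] using DFunLike.congr_fun h 1)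

/-- The binary quartic form with coefficients `q 0, …, q 4`, in decreasing powers of `X 0` and
without binomial factors. -/
noncomputable def binaryQuartic (q : Fin 5 → R) : MvPolynomial (Fin 2) R :=
  ∑ i, monomial (quarticExponent i) (q i)

theorem binaryQuartic_eq (q : Fin 5 → R) :
    binaryQuartic q = C (q 0) * X 0 ^ 4 + C (q 1) * X 0 ^ 3 * X 1 + C (q 2) * X 0 ^ 2 * X 1 ^ 2
      + C (q 3) * X 0 * X 1 ^ 3 + C (q 4) * X 1 ^ 4 := by
  simp [binaryQuartic, Fin.sum_univ_five, quarticExponent, monomial_eq, Finsupp.prod_fintype,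
    mul_assoc]

theorem coeff_binaryQuartic (q : Fin 5 → R) (i : Fin 5) :
    coeff (quarticExponent i) (binaryQuartic q) = q i := by
  simp [binaryQuartic, coeff_sum, coeff_monomial, quarticExponent_injective.eq_iff]

theorem binaryQuartic_injective : Function.Injective (binaryQuartic (R := R)) := by
  intro p q h
  ext i
  rw [← coeff_binaryQuartic p, h, coeff_binaryQuartic]

theorem binaryQuartic_smul (k : R) (q : Fin 5 → R) :
    binaryQuartic (k • q) = k • binaryQuartic q := by
  simp only [binaryQuartic, Finset.smul_sum, smul_monomial, Pi.smul_apply]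

/-- The coefficients of the quartic `q` after the linear substitution `M`. -/
def quarticSubst (M : Matrix (Fin 2) (Fin 2) R) (q : Fin 5 → R) : Fin 5 → R :=
  let a := M 0 0; let b := M 0 1; let c := M 1 0; let d := M 1 1
  ![q 0 * a ^ 4 + q 1 * a ^ 3 * c + q 2 * a ^ 2 * c ^ 2 + q 3 * a * c ^ 3 + q 4 * c ^ 4,
    q 0 * (4 * a ^ 3 * b) + q 1 * (3 * a ^ 2 * b * c + a ^ 3 * d)
      + q 2 * (2 * a * b * c ^ 2 + 2 * a ^ 2 * c * d) + q 3 * (b * c ^ 3 + 3 * a * c ^ 2 * d)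
      + q 4 * (4 * c ^ 3 * d),
    q 0 * (6 * a ^ 2 * b ^ 2) + q 1 * (3 * a * b ^ 2 * c + 3 * a ^ 2 * b * d)
      + q 2 * (b ^ 2 * c ^ 2 + 4 * a * b * c * d + a ^ 2 * d ^ 2)
      + q 3 * (3 * b * c ^ 2 * d + 3 * a * c * d ^ 2) + q 4 * (6 * c ^ 2 * d ^ 2),
    q 0 * (4 * a * b ^ 3) + q 1 * (b ^ 3 * c + 3 * a * b ^ 2 * d)
      + q 2 * (2 * b ^ 2 * c * d + 2 * a * b * d ^ 2) + q 3 * (3 * b * c * d ^ 2 + a * d ^ 3)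
      + q 4 * (4 * c * d ^ 3),
    q 0 * b ^ 4 + q 1 * b ^ 3 * d + q 2 * b ^ 2 * d ^ 2 + q 3 * b * d ^ 3 + q 4 * d ^ 4]

theorem linSubst_binaryQuartic (M : Matrix (Fin 2) (Fin 2) R) (q : Fin 5 → R) :
    linSubst M (binaryQuartic q) = binaryQuartic (quarticSubst M q) := by
  have hC (r : R) : linSubst M (C r) = C r := algHom_C _ r
  simp only [binaryQuartic_eq, quarticSubst, map_add, map_mul, map_pow, hC, linSubst_X,
    Fin.sum_univ_two, cons_val_zero, cons_val_one, cons_val, map_ofNat C]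
  ring

/-- The degree 2 invariant `I` of binary quartics (classically `ae - 4bd + 3c²` for coefficients
with binomial factors), scaled by `12` to have integral coefficients. -/
def quarticI (q : Fin 5 → R) : R :=
  12 * q 0 * q 4 - 3 * q 1 * q 3 + q 2 ^ 2

/-- The degree 3 invariant `J` of binary quartics (classically the catalecticant), scaled by `432`
to have integral coefficients. -/
def quarticJ (q : Fin 5 → R) : R :=
  72 * q 0 * q 2 * q 4 + 9 * q 1 * q 2 * q 3 - 27 * q 0 * q 3 ^ 2 - 27 * q 1 ^ 2 * q 4
    - 2 * q 2 ^ 3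

theorem quarticI_smul (k : R) (q : Fin 5 → R) : quarticI (k • q) = k ^ 2 * quarticI q := by
  simp only [quarticI, Pi.smul_apply, smul_eq_mul]
  ring

theorem quarticJ_smul (k : R) (q : Fin 5 → R) : quarticJ (k • q) = k ^ 3 * quarticJ q := by
  simp only [quarticJ, Pi.smul_apply, smul_eq_mul]
  ring

theorem quarticI_familyForm (t : R) : quarticI ![1, t, 0, 0, 1] = 12 := by
  simp [quarticI]

theorem quarticJ_familyForm (t : R) : quarticJ ![1, t, 0, 0, 1] = -27 * t ^ 2 := by
  simp [quarticJ]

theorem quarticI_quarticSubst (M : Matrix (Fin 2) (Fin 2) R) (q : Fin 5 → R) :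
    quarticI (quarticSubst M q) = M.det ^ 4 * quarticI q := by
  simp only [quarticI, quarticSubst, det_fin_two, cons_val_zero, cons_val_one, cons_val]
  ring

theorem quarticJ_quarticSubst (M : Matrix (Fin 2) (Fin 2) R) (q : Fin 5 → R) :
    quarticJ (quarticSubst M q) = M.det ^ 6 * quarticJ q := by
  simp only [quarticJ, quarticSubst, det_fin_two, cons_val_zero, cons_val_one, cons_val]
  ring

theorem familyForm_four (t : ℂ) : familyForm 4 t = binaryQuartic ![1, t, 0, 0, 1] := by
  simp [familyForm, binaryQuartic_eq]

theorem pow_eq_pow_of_linSubst_familyForm_four_eq {s t : ℂ} {M : Matrix (Fin 2) (Fin 2) ℂ} {k : ℂ}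
    (hk : k ≠ 0) (h : linSubst M (familyForm 4 s) = k • familyForm 4 t) : s ^ 4 = t ^ 4 := by
  have hq : quarticSubst M ![1, s, 0, 0, 1] = k • ![1, t, 0, 0, 1] := by
    apply binaryQuartic_injective
    rw [← linSubst_binaryQuartic, ← familyForm_four, h, familyForm_four, binaryQuartic_smul]
  have hI : M.det ^ 4 = k ^ 2 := by
    have hsubst := quarticI_quarticSubst M ![1, s, 0, 0, 1]
    rw [hq, quarticI_smul, quarticI_familyForm, quarticI_familyForm] at hsubst
    linear_combination -hsubst / 12
  have hJ : M.det ^ 6 * s ^ 2 = k ^ 3 * t ^ 2 := by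
    have hsubst := quarticJ_quarticSubst M ![1, s, 0, 0, 1]
    rw [hq, quarticJ_smul, quarticJ_familyForm, quarticJ_familyForm] at hsubst
    linear_combination hsubst / 27
  refine mul_left_cancel₀ (pow_ne_zero 6 hk) ?_
  calc k ^ 6 * s ^ 4 = (M.det ^ 6 * s ^ 2) ^ 2 := by
        linear_combination (-s ^ 4) * congrArg (· ^ 3) hI
    _ = k ^ 6 * t ^ 4 := by rw [hJ]; ring

end BinaryQuartic

theorem pow_eq_pow_of_isLinearlyEquivalent {n : ℕ} (hn : 4 ≤ n) {s t : ℂ}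
    (h : IsLinearlyEquivalent (familyForm n s) (familyForm n t)) : s ^ n = t ^ n := by
  rcases hn.eq_or_lt with rfl | hn5
  · obtain ⟨M, k, h⟩ := h
    exact pow_eq_pow_of_linSubst_familyForm_four_eq k.ne_zero h
  rcases ne_or_eq s 0 with hs | rfl
  · obtain ⟨M, k, h⟩ := h
    exact pow_eq_pow_of_linSubst_familyForm_eq_of_five_le hn5 hs k.ne_zero h
  rcases ne_or_eq t 0 with ht | rfl
  · obtain ⟨M, k, h⟩ := h.symm
    exact (pow_eq_pow_of_linSubst_familyForm_eq_of_five_le hn5 ht k.ne_zero h).symm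
  · rfl

section TangentMap

variable {𝕜 : Type*} [NontriviallyNormedField 𝕜]

theorem eval_smul_of_isHomogeneous {σ R : Type*} [CommSemiring R] {p : MvPolynomial σ R} {n : ℕ}
    (hp : p.IsHomogeneous n) (r : R) (v : σ → R) : eval (r • v) p = r ^ n * eval v p := by
  simp only [eval_eq, Finset.mul_sum]
  refine Finset.sum_congr rfl fun d hd => ?_
  have hdeg : ∑ i ∈ d.support, d i = n := (hp.degree_eq_sum_deg_support hd).symm
  simp only [Pi.smul_apply, smul_eq_mul, mul_pow, Finset.prod_mul_distrib,
    Finset.prod_pow_eq_pow_sum, hdeg]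
  ring

theorem eval_eq_zero_of_hasFDerivAt {σ τ : Type*} [Finite σ] [Finite τ]
    {f : MvPolynomial σ 𝕜} {g : MvPolynomial τ 𝕜} {m n : ℕ} (hf : f.IsHomogeneous m)
    (hg : g.IsHomogeneous n) {F : (σ → 𝕜) → τ → 𝕜} {A : (σ → 𝕜) →L[𝕜] τ → 𝕜}
    (hF : HasFDerivAt F A 0) (hF0 : F 0 = 0)
    (hV : ∀ᶠ p in 𝓝 0, eval p f = 0 → eval (F p) g = 0) {v : σ → 𝕜} (hv : eval v f = 0) :
    eval (A v) g = 0 := by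
  have := Fintype.ofFinite σ
  have := Fintype.ofFinite τ
  have hray : HasDerivAt (fun r : 𝕜 => r • v) v 0 := by
    simpa using (hasDerivAt_id (0 : 𝕜)).smul_const v
  have hslope : Tendsto (fun r : 𝕜 => r⁻¹ • F (r • v)) (𝓝[≠] 0) (𝓝 (A v)) := by
    have hcurve : HasDerivAt (fun r : 𝕜 => F (r • v)) (A v) 0 :=
      HasFDerivAt.comp_hasDerivAt (0 : 𝕜) (by simpa using hF) hray
    simpa [hF0] using hcurve.tendsto_slope_zero
  have heval := ((MvPolynomial.continuous_eval g).tendsto (A v)).comp hslope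
  have hsmul : Tendsto (fun r : 𝕜 => r • v) (𝓝[≠] 0) (𝓝 0) := by
    simpa using hray.continuousAt.tendsto.mono_left nhdsWithin_le_nhds
  refine tendsto_nhds_unique heval (tendsto_const_nhds.congr' ?_)
  filter_upwards [hsmul.eventually hV] with r hr
  have hFr : eval (F (r • v)) g = 0 :=
    hr (by rw [eval_smul_of_isHomogeneous hf, hv, mul_zero])
  simp only [Function.comp_apply, eval_smul_of_isHomogeneous hg, hFr, mul_zero]

theorem exists_fderiv_eq_mulVec {ι : Type*} [Fintype ι] [DecidableEq ι]
    (F : OpenPartialHomeomorph (ι → 𝕜) (ι → 𝕜)) {x : ι → 𝕜} (hx : x ∈ F.source)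
    (hF : DifferentiableAt 𝕜 F x) (hG : DifferentiableAt 𝕜 F.symm (F x)) :
    ∃ M : GL ι 𝕜, ∀ v, fderiv 𝕜 F x v = M.1 *ᵥ v := by
  have hcomp : (fderiv 𝕜 F.symm (F x)).comp (fderiv 𝕜 F x) = .id 𝕜 (ι → 𝕜) :=
    (hG.hasFDerivAt.comp x hF.hasFDerivAt).unique
      ((hasFDerivAt_id x).congr_of_eventuallyEq (F.eventually_left_inverse hx))
  have hmul : LinearMap.toMatrix' (fderiv 𝕜 F.symm (F x)).toLinearMap *
      LinearMap.toMatrix' (fderiv 𝕜 F x).toLinearMap = 1 := by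
    rw [← LinearMap.toMatrix'_comp, ← ContinuousLinearMap.toLinearMap_comp, hcomp,
      ContinuousLinearMap.coe_id, LinearMap.toMatrix'_id]
  exact ⟨⟨_, _, mul_eq_one_comm.mp hmul, hmul⟩, fun v => (LinearMap.toMatrix'_mulVec _ v).symm⟩

end TangentMap

section HomogeneousGerm

theorem germAtZero_eq_iff {V W : Set C2} :
    germAtZero V = germAtZero W ↔ ∀ᶠ p in 𝓝 (0 : C2), p ∈ V ↔ p ∈ W := by
  simp only [germAtZero, Germ.coe_eq, EventuallyEq, eq_iff_iff]

theorem eventually_mem_of_germAtZero_eq {F : C2 → C2} (hF : ContinuousAt F 0) (hF0 : F 0 = 0)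
    {V W : Set C2} (hV : germAtZero V = germAtZero W) {V' W' : Set C2}
    (hV' : germAtZero V' = germAtZero W') (h : F '' V = V') :
    ∀ᶠ p in 𝓝 0, p ∈ W → F p ∈ W' := by
  have hF0 : Tendsto F (𝓝 0) (𝓝 0) := by simpa [ContinuousAt, hF0] using hF
  filter_upwards [germAtZero_eq_iff.mp hV, hF0.eventually (germAtZero_eq_iff.mp hV')]
    with p hp hFp hpW
  exact hFp.mp (h ▸ Set.mem_image_of_mem F (hp.mpr hpW))

theorem BiholomorphicallyEquivalent.symm {𝒱₁ 𝒱₂ : SetGerm}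
    (h : BiholomorphicallyEquivalent 𝒱₁ 𝒱₂) : BiholomorphicallyEquivalent 𝒱₂ 𝒱₁ := by
  obtain ⟨F, h0, hF0, hF, hG, V₁, V₂, hV₁, hV₂, hg₁, hg₂, rfl⟩ := h
  refine ⟨F.symm, by simpa [hF0] using F.map_source h0, by simpa [hF0] using F.left_inv h0,
    hG, hF, _, V₁, hV₂, hV₁, hg₂, hg₁, ?_⟩
  obtain ⟨-, -, f, -, -, rfl⟩ := hV₁
  exact F.symm_image_image_of_subset_source (Set.sep_subset _ _)

theorem isLinearlyEquivalent_of_biholomorphicallyEquivalent {n : ℕ} {f g : MvPolynomial (Fin 2) ℂ}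
    (hf : Squarefree f) (hfn : f.IsHomogeneous n) (hg : g ≠ 0) (hgn : g.IsHomogeneous n)
    (h : BiholomorphicallyEquivalent (germAtZero {p | eval p f = 0})
      (germAtZero {p | eval p g = 0})) : IsLinearlyEquivalent f g := by
  obtain ⟨F, h0, hF0, hF, hG, V₁, V₂, -, -, hV₁, hV₂, hV⟩ := h
  have hFd : DifferentiableAt ℂ F 0 := hF.differentiableAt (F.open_source.mem_nhds h0)
  have hGd : DifferentiableAt ℂ F.symm (F 0) :=
    hG.differentiableAt (F.open_target.mem_nhds (F.map_source h0))
  obtain ⟨M, hM⟩ := exists_fderiv_eq_mulVec F h0 hFd hGd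
  have hmaps := eventually_mem_of_germAtZero_eq hFd.continuousAt hF0 hV₁ hV₂ hV
  refine .symm ⟨M, exists_eq_smul_of_forall_eval_eq_zero hf hfn (isHomogeneous_linSubst M.1 hgn)
    (linSubst_ne_zero M hg) fun v hv => ?_⟩
  rw [eval_linSubst, ← hM]
  exact eval_eq_zero_of_hasFDerivAt hfn hgn hFd.hasFDerivAt hF0 hmaps hv

theorem isPlaneCurveIn_univ_of_ne_zero {f : MvPolynomial (Fin 2) ℂ} (hf : f ≠ 0) :
    IsPlaneCurveIn {p | eval p f = 0} Set.univ := by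
  obtain ⟨p, hp⟩ : ∃ p, eval p f ≠ 0 := by
    by_contra! h
    exact hf (MvPolynomial.funext fun p => by rw [h, map_zero])
  refine ⟨isOpen_univ, isConnected_univ, fun p => eval p f, ?_, ⟨p, trivial, hp⟩, by simp⟩
  exact (AnalyticOnNhd.eval_mvPolynomial f).differentiableOn

theorem biholomorphicallyEquivalent_of_isLinearlyEquivalent {f g : MvPolynomial (Fin 2) ℂ}
    (hf : f ≠ 0) (hg : g ≠ 0) (h : IsLinearlyEquivalent f g) :
    BiholomorphicallyEquivalent (germAtZero {p | eval p f = 0})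
      (germAtZero {p | eval p g = 0}) := by
  obtain ⟨M, k, hM⟩ := h.symm
  let F : C2 ≃L[ℂ] C2 :=
    (toLin'OfInv M.inv_mul M.mul_inv).toContinuousLinearEquiv
  have hpre : F ⁻¹' {p | eval p g = 0} = {p | eval p f = 0} := by
    ext p
    have hFp : eval (F p) g = k * eval p f := by
      rw [← smul_eval, ← Units.smul_def, ← hM, eval_linSubst]
      rfl
    simp [hFp]
  refine ⟨F.toHomeomorph.toOpenPartialHomeomorph, trivial, map_zero F,
    F.differentiable.differentiableOn, F.symm.differentiable.differentiableOn, _, _,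
    isPlaneCurveIn_univ_of_ne_zero hf, isPlaneCurveIn_univ_of_ne_zero hg, rfl, rfl, ?_⟩
  rw [← hpre]
  exact Set.image_preimage_eq _ F.surjective

end HomogeneousGerm

theorem theorem1p1_general (n : ℕ) (hn : 4 ≤ n) (t₁ t₂ : ℂ) :
    BiholomorphicallyEquivalent (curveGerm n t₁) (curveGerm n t₂) ↔ t₁ ^ n = t₂ ^ n := by
  have hn1 : 1 ≤ n := by omega
  have of_squarefree {s t : ℂ} (hs : Squarefree (familyForm n s))
      (h : BiholomorphicallyEquivalent (curveGerm n s) (curveGerm n t)) : s ^ n = t ^ n :=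
    pow_eq_pow_of_isLinearlyEquivalent hn
      (isLinearlyEquivalent_of_biholomorphicallyEquivalent hs (isHomogeneous_familyForm hn1 s)
        (familyForm_ne_zero hn1 t) (isHomogeneous_familyForm hn1 t) h)
  refine ⟨fun h => ?_, fun h => ?_⟩
  · by_cases h₁ : Squarefree (familyForm n t₁)
    · exact of_squarefree h₁ h
    by_cases h₂ : Squarefree (familyForm n t₂)
    · exact (of_squarefree h₂ h.symm).symm
    exact pow_eq_pow_of_not_squarefree (by omega) h₁ h₂
  · exact biholomorphicallyEquivalent_of_isLinearlyEquivalent (familyForm_ne_zero hn1 t₁)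
      (familyForm_ne_zero hn1 t₂) (isLinearlyEquivalent_of_pow_eq_pow (by omega) h)

theorem theorem1p1 (n : ℕ) (hn : 4 ≤ n) (t₁ t₂ : ℂ)
    (h₁ : Squarefree (familyForm n t₁)) (h₂ : Squarefree (familyForm n t₂)) :
    BiholomorphicallyEquivalent (curveGerm n t₁) (curveGerm n t₂) ↔ t₁ ^ n = t₂ ^ n :=
  theorem1p1_general n hn t₁ t₂
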